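/- **Theorem 1 (Fermionic source coding).** *Setting.* The Fock space $\mathcal F_M$ of $M$ local fermionic modes has the occupation-number basis $|n_1,\dots,n_M\rangle$, $n_i\in\{0,1\}$, and splits into an even and an odd sector according to the parity of $\sum_i n_i$. All operators are written in this basis (Jordan–Wigner representation). An operator between two Fock spaces is *even* if it preserves the sectors and *odd* if it exchanges them. A normalized fermionic state is a positive semidefinite even operator of trace $1$; it is pure if it has rank one. A fermionic channel is a trace-preserving completely positive map $X\mapsto\sum_i C_iXC_i^\dagger$ ($\sum_i C_i^\dagger C_i=I$) whose Kraus operators $C_i$ can be chosen so that each of them is even or odd. Systems are composed by juxtaposing their modes, those of the first system coming first in the Jordan–Wigner ordering; then $\mathcal C\boxtimes\mathcal I$ has Kraus operators $C_i\otimes I$, the fermionic partial trace over the last modes is the partial trace over the last tensor factor, and $\rho^{\boxtimes N}$ is represented by $\rho^{\otimes N}$. A purification of a state $\rho$ is a pure fermionic state $\Phi$ on the modes of $\rho$ and $K\ge 0$ further modes with marginal $\rho$. The Uhlmann fidelity is $F(\rho,\sigma)=\operatorname{Tr}(\rho^{1/2}\sigma\rho^{1/2})^{1/2}$, the entanglement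 fidelity of a channel $\mathcal C$ on $\rho$ is $F(\rho,\mathcal C)=F(\Phi,(\mathcal C\boxtimes\mathcal I)(\Phi))^2$ for any purification $\Phi$ of $\rho$, purifications existing and the value being the same for all of them, and $S_f(\rho)=-\operatorname{Tr}(\rho\log_2\rho)$. A compression scheme for $N$ uses of a source on $L$ modes is a pair of fermionic channels $\mathcal E$ (from $NL$ modes to $M$ modes) and $\mathcal D$ (from $M$ modes to $NL$ modes), for some $M\ge 0$; its rate is $\frac1N\log_2\dim\mathcal F_M=M/N$. *Statement.* Let $\rho$ be a normalized fermionic state on $L\ge 0$ modes. 1. (Direct part.) For every $R>S_f(\rho)$ and every $\delta>0$ there is $N_0$ such that for every $N\ge N_0$ there is a compression scheme $(\mathcal E_N,\mathcal D_N)$ with rate in $(R-\frac1N,R]$ (that is, of rate $R$ up to rounding the number of modes down) and $F(\rho^{\boxtimes N},\mathcal D_N\mathcal E_N)\ge 1-\delta$. 2. (Converse.) For every $R<S_f(\rho)$ and every $\delta>0$ there is $N_0$ such that for every $N\ge N_0$ and every compression scheme $(\mathcal E_N,\mathcal D_N)$ of rate at most $R$ one has $F(\rho^{\boxtimes N},\mathcal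 D_N\mathcal E_N)\le\delta$. 3. Let $\rho=\sum_x p_x|x\rangle\langle x|$ be an orthonormal eigendecomposition. For every $N\ge1$ and every $\varepsilon>0$ the projector $P_{N,\varepsilon}(\rho)=\sum |x_1\rangle\langle x_1|\otimes\cdots\otimes|x_N\rangle\langle x_N|$, summed over the sequences $(x_1,\dots,x_N)$ with $p=p_{x_1}\cdots p_{x_N}>0$ and $\left|\frac1N\log_2\frac1p-S_f(\rho)\right|\le\varepsilon$, is an admissible fermionic Kraus operator: it is even or odd, and $P_{N,\varepsilon}(\rho)^\dagger P_{N,\varepsilon}(\rho)\le I$. -/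

import Mathlib

open scoped ComplexOrder

/-- Occupation-number configurations `n₁, n₂, …` (each `0` or `1`) of a finite set `ι` of local
fermionic modes.  They label the Fock basis, i.e. the computational basis of the qubits of the
Jordan–Wigner representation. -/
abbrev Occ (ι : Type) : Type := ι → ZMod 2

/-- Operators from the Fock space of the modes `ι` to the Fock space of the modes `κ`, as matrices
in the Fock bases (the Jordan–Wigner representatives). -/
abbrev FockHom (ι κ : Type) : Type := Matrix (Occ κ) (Occ ι) ℂ

/-- Operators on the Fock space of the modes `ι`, as matrices in the Fock basis. -/
abbrev FockOp (ι : Type) : Type := Matrix (Occ ι) (Occ ι) ℂ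

/-- Parity of the total occupation number. -/
def parity {ι : Type} [Fintype ι] (s : Occ ι) : ZMod 2 := ∑ i, s i

/-- Even operators: they map the even sector to the even sector and the odd sector to the odd one.
On one system these are the linear combinations of products of an even number of fields. -/
def IsEvenOp {ι κ : Type} [Fintype ι] [Fintype κ] (X : FockHom ι κ) : Prop :=
  ∀ s t, parity s ≠ parity t → X s t = 0

/-- Odd operators: they exchange the even and the odd sector.
On one system these are the linear combinations of products of an odd number of fields. -/
def IsOddOp {ι κ : Type} [Fintype ι] [Fintype κ] (X : FockHom ι κ) : Prop :=
  ∀ s t, parity s = parity t → X s t = 0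

/-- Normalized fermionic states: density matrices `ρ = ρₑ + ρₒ` that are block diagonal with respect
to the decomposition of the Fock space into its even and odd sectors. -/
structure IsNormalizedState {ι : Type} [Fintype ι] [DecidableEq ι] (ρ : FockOp ι) : Prop where
  posSemidef : ρ.PosSemidef
  even : IsEvenOp ρ
  trace_eq_one : ρ.trace = 1

/-- Fermionic channels: trace-preserving completely positive maps that admit Kraus operators each of
which is even or odd. -/
def IsFermionicChannel {ι κ : Type} [Fintype ι] [DecidableEq ι] [Fintype κ]
    [DecidableEq κ] (T : FockOp ι →ₗ[ℂ] FockOp κ) : Prop :=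
  ∃ (n : ℕ) (C : Fin n → FockHom ι κ),
    (∀ i, IsEvenOp (C i) ∨ IsOddOp (C i)) ∧
    ∑ i, (C i).conjTranspose * C i = 1 ∧
    ∀ X, T X = ∑ i, C i * X * (C i).conjTranspose

/-- Admissible fermionic Kraus operators: `X ↦ K X K†` is a fermionic transformation. -/
def IsAdmissibleKraus {ι κ : Type} [Fintype ι] [DecidableEq ι] [Fintype κ]
    [DecidableEq κ] (K : FockHom ι κ) : Prop :=
  (IsEvenOp K ∨ IsOddOp K) ∧ (1 - K.conjTranspose * K).PosSemidef

/-- The extension `T ⊠ I` of a map `T` to a composite system with ancillary modes `α`.  The modes of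
`ι` (and of `κ`) precede those of `α` in the Jordan–Wigner ordering, so that an operator built from
the fields of the first modes acts as `C ⊗ 1`, and `T ⊠ I` has the Kraus operators `C i ⊗ 1`. -/
def extendChannel {ι κ : Type} (α : Type) (T : FockOp ι →ₗ[ℂ] FockOp κ)
    (Ψ : FockOp (ι ⊕ α)) : FockOp (κ ⊕ α) :=
  Matrix.of fun u v =>
    T (Matrix.of fun s t => Ψ (Sum.elim s fun a => u (Sum.inr a)) (Sum.elim t fun a => v (Sum.inr a)))
      (fun k => u (Sum.inl k)) (fun k => v (Sum.inl k))

/-- The fermionic partial trace over the modes `α`, which follow those of `ι` in the Jordan–Wigner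
ordering: the terms that are off-diagonal in the occupation of a mode of `α` are dropped, and the
fields of `α` are removed from the others. -/
def fermionicPartialTrace {ι α : Type} [Fintype α] [DecidableEq α]
    (Ψ : FockOp (ι ⊕ α)) : FockOp ι :=
  Matrix.of fun s t => ∑ a : Occ α, Ψ (Sum.elim s a) (Sum.elim t a)

/-- `Φ` is a purification of the normalized state `ρ`: a fermionic state on a composite system that
is pure (of rank one) and whose marginal is `ρ`. -/
structure IsPurification {ι α : Type} [Fintype ι] [DecidableEq ι] [Fintype α] [DecidableEq α]
    (ρ : FockOp ι) (Φ : FockOp (ι ⊕ α)) : Prop where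
  state : IsNormalizedState Φ
  pure : ∃ v : Occ (ι ⊕ α) → ℂ, Φ = Matrix.vecMulVec v (star v)
  marginal : fermionicPartialTrace Φ = ρ

/-- The square root of a fermionic state, by functional calculus. -/
noncomputable def sqrtOp {ι : Type} [Fintype ι] [DecidableEq ι] (ρ : FockOp ι) : FockOp ι :=
  cfc Real.sqrt ρ

/-- The base-two logarithm of a fermionic state, by functional calculus. -/
noncomputable def log2Op {ι : Type} [Fintype ι] [DecidableEq ι] (ρ : FockOp ι) : FockOp ι :=
  cfc (Real.logb 2) ρ

/-- Von Neumann entropy `S_f(ρ) = - Tr (ρ log₂ ρ)`, in bits. -/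
noncomputable def fermionicEntropy {ι : Type} [Fintype ι] [DecidableEq ι] (ρ : FockOp ι) : ℝ :=
  -(ρ * log2Op ρ).trace.re

/-- Uhlmann fidelity `Tr (ρ^{1/2} σ ρ^{1/2})^{1/2}`. -/
noncomputable def uhlmannFidelity {ι : Type} [Fintype ι] [DecidableEq ι] (ρ σ : FockOp ι) : ℝ :=
  (sqrtOp (sqrtOp ρ * σ * sqrtOp ρ)).trace.re

/-- `F` is the entanglement fidelity of the channel `C` on the state `ρ`: purifications of `ρ` exist,
and each of them gives the value `F`. -/
def IsEntanglementFidelity {ι : Type} [Fintype ι] [DecidableEq ι]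
    (ρ : FockOp ι) (C : FockOp ι →ₗ[ℂ] FockOp ι) (F : ℝ) : Prop :=
  (∃ (K : ℕ) (Φ : FockOp (ι ⊕ Fin K)), IsPurification ρ Φ) ∧
  ∀ (K : ℕ) (Φ : FockOp (ι ⊕ Fin K)), IsPurification ρ Φ →
    F = uhlmannFidelity Φ (extendChannel (Fin K) C Φ) ^ 2

/-- `N` independent copies `ρ ⊠ ⋯ ⊠ ρ` of a fermionic state, on `N` successive blocks of modes; the
Jordan–Wigner representative is the tensor power. -/
def parallelPower {ι : Type} (ρ : FockOp ι) (N : ℕ) : FockOp (Fin N × ι) :=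
  Matrix.of fun s t => ∏ j, ρ (fun i => s (j, i)) (fun i => t (j, i))

/-- A fermionic compression scheme for `N` uses of a source on `L` modes: an encoding channel into a
system of `modes` fermionic modes and a decoding channel. -/
structure CompressionScheme (L N : ℕ) where
  modes : ℕ
  encode : FockOp (Fin N × Fin L) →ₗ[ℂ] FockOp (Fin modes)
  decode : FockOp (Fin modes) →ₗ[ℂ] FockOp (Fin N × Fin L)
  encode_channel : IsFermionicChannel encode
  decode_channel : IsFermionicChannel decode

/-- The compression map, decoding after encoding. -/
def CompressionScheme.compression {L N : ℕ} (c : CompressionScheme L N) :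
    FockOp (Fin N × Fin L) →ₗ[ℂ] FockOp (Fin N × Fin L) :=
  c.decode ∘ₗ c.encode

/-- The rate `log₂ d / N`, with `d` the dimension of the Fock space of the encoded system. -/
noncomputable def CompressionScheme.rate {L N : ℕ} (c : CompressionScheme L N) : ℝ :=
  Real.logb 2 (Fintype.card (Occ (Fin c.modes)) : ℝ) / (N : ℝ)

/-- The projector on the `ε`-typical subspace: the sum of `|x₁⟩⟨x₁| ⊗ ⋯ ⊗ |x_N⟩⟨x_N|` over the
sequences of eigenvectors of `ρ` that have positive probability `p` with
`|(1/N) log₂ (1/p) - S_f(ρ)| ≤ ε`. -/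
noncomputable def typicalProjector {ι : Type} [Fintype ι] [DecidableEq ι] (ρ : FockOp ι)
    (hρ : ρ.IsHermitian) (N : ℕ) (ε : ℝ) : FockOp (Fin N × ι) :=
  open Classical in
  ∑ x : Fin N → Occ ι,
    if 0 < ∏ j, hρ.eigenvalues (x j) ∧
        |1 / (N : ℝ) * Real.logb 2 (1 / ∏ j, hρ.eigenvalues (x j)) - fermionicEntropy ρ| ≤ ε
    then
      Matrix.vecMulVec (fun u => ∏ j, hρ.eigenvectorBasis (x j) fun i => u (j, i))
        (star fun u => ∏ j, hρ.eigenvectorBasis (x j) fun i => u (j, i))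
    else 0

/-! For a map with Kraus operators C_i, the entanglement fidelity on ρ is ∑ |Tr(ρ C_i)|², because
the overlap of a purifying vector v with (C ⊗ 1)v sees only the marginal of v
(`isEntanglementFidelity_of_kraus`). Purifications thus disappear, and Schumacher's argument applies
once parity superselection is shown to cost at most one mode.

The tensor power of ρ is diagonal in product eigenvectors, with the product probabilities as
eigenvalues. Chebyshev's inequality makes the weight of atypical sequences O(1/N)
(`sum_not_isTypical_le`), while typical probabilities lie between 2^(-N(S+ε)) and 2^(-N(S-ε)).

Direct part: the typical projector P is a function of the tensor power, hence even, and has rank at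
most 2^(N(S+ε)). Its even and odd blocks must each fit into the sector of the same parity; with one
extra mode each sector is large enough, so P = V V† with V even
(`exists_isEvenOp_mul_conjTranspose_eq_projection`). Completing V† and V to fermionic channels gives
fidelity at least |Tr(ρ^⊗N P)|².

Converse: let Q project onto the range of a decoding Kraus operator C. Cauchy–Schwarz bounds
|Tr(σCA)|² by Tr(σQ) · Tr(σ(CA)†CA), and the second factors sum to 1. The fidelity is therefore at
most the largest weight of σ = ρ^⊗N on a subspace of dimension 2^M
(`exists_isEntanglementFidelity_le`), which is at most 2^M · 2^(-N(S-ε)) plus the atypical weight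
(`re_trace_ofSpectrum_mul_projection_le`). -/

/-- The operator with eigenvalues `p` along the columns of `U`. -/
noncomputable def ofSpectrum {n m : Type*} [Fintype m] [DecidableEq m]
    (U : Matrix n m ℂ) (p : m → ℝ) : Matrix n n ℂ :=
  U * Matrix.diagonal (fun x => (p x : ℂ)) * U.conjTranspose

/-! ### Matrices given by a spectral decomposition -/

section OfSpectrum

open Matrix

variable {n m : Type*} [Fintype m] [DecidableEq m]

theorem ofSpectrum_apply (U : Matrix n m ℂ) (p : m → ℝ) (s t : n) :
    ofSpectrum U p s t = ∑ x, (p x : ℂ) * U s x * star (U t x) := by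
  rw [ofSpectrum, mul_apply]
  refine Finset.sum_congr rfl fun x _ => ?_
  rw [mul_diagonal, conjTranspose_apply]
  ring

theorem isHermitian_ofSpectrum (U : Matrix n m ℂ) (p : m → ℝ) :
    (ofSpectrum U p).IsHermitian := by
  have h : (diagonal (fun x => (p x : ℂ))).conjTranspose = diagonal (fun x => (p x : ℂ)) := by
    rw [diagonal_conjTranspose]
    congr 1
    ext x
    simp
  rw [IsHermitian, ofSpectrum, conjTranspose_mul, conjTranspose_mul, h,
    conjTranspose_conjTranspose, Matrix.mul_assoc]

theorem ofSpectrum_one [DecidableEq n] {U : Matrix n m ℂ} (hU : U * Uᴴ = 1) :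
    ofSpectrum U (fun _ => 1) = 1 := by
  simpa [ofSpectrum] using hU

variable [Fintype n]

theorem ofSpectrum_mul {U : Matrix n m ℂ} (hU : Uᴴ * U = 1) (p q : m → ℝ) :
    ofSpectrum U p * ofSpectrum U q = ofSpectrum U (fun x => p x * q x) := by
  have : ofSpectrum U p * ofSpectrum U q =
      U * diagonal (fun x => (p x : ℂ)) * (Uᴴ * U) * diagonal (fun x => (q x : ℂ)) * Uᴴ := by
    simp only [ofSpectrum, Matrix.mul_assoc]
  rw [this, hU, Matrix.mul_one, Matrix.mul_assoc U, diagonal_mul_diagonal]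
  simp [ofSpectrum]

theorem trace_ofSpectrum_mul (U : Matrix n m ℂ) (p : m → ℝ) (A : Matrix n n ℂ) :
    (ofSpectrum U p * A).trace = ∑ x, (p x : ℂ) * (Uᴴ * A * U) x x := by
  rw [ofSpectrum, Matrix.mul_assoc, trace_mul_comm, ← Matrix.mul_assoc, trace_mul_comm, trace]
  simp [diagonal_mul]

theorem trace_ofSpectrum {U : Matrix n m ℂ} (hU : Uᴴ * U = 1) (p : m → ℝ) :
    (ofSpectrum U p).trace = ∑ x, (p x : ℂ) := by
  rw [ofSpectrum, trace_mul_comm, ← Matrix.mul_assoc, hU, Matrix.one_mul, trace_diagonal]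

theorem posSemidef_ofSpectrum (U : Matrix n m ℂ) {p : m → ℝ} (hp : ∀ x, 0 ≤ p x) :
    (ofSpectrum U p).PosSemidef :=
  (PosSemidef.diagonal (d := fun x => (p x : ℂ))
    fun x => by simpa using hp x).mul_mul_conjTranspose_same U

theorem rank_ofSpectrum_le (U : Matrix n m ℂ) (p : m → ℝ) :
    (ofSpectrum U p).rank ≤ Fintype.card {x // p x ≠ 0} := by
  refine (rank_mul_le_left _ _).trans ((rank_mul_le_right _ _).trans ?_)
  rw [rank_diagonal]
  exact le_of_eq (Fintype.card_congr (Equiv.subtypeEquivRight fun x => by simp))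

/-- The spectral theorem for Hermitian matrices. -/
theorem _root_.Matrix.IsHermitian.eq_ofSpectrum [DecidableEq n] {A : Matrix n n ℂ}
    (hA : A.IsHermitian) :
    A = ofSpectrum (hA.eigenvectorUnitary : Matrix n n ℂ) hA.eigenvalues :=
  hA.spectral_theorem

theorem _root_.Matrix.IsHermitian.eigenvectorUnitary_conjTranspose_mul [DecidableEq n]
    {A : Matrix n n ℂ} (hA : A.IsHermitian) :
    (hA.eigenvectorUnitary : Matrix n n ℂ)ᴴ * (hA.eigenvectorUnitary : Matrix n n ℂ) = 1 :=
  Unitary.coe_star_mul_self hA.eigenvectorUnitary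

theorem _root_.Matrix.IsHermitian.eigenvectorUnitary_mul_conjTranspose [DecidableEq n]
    {A : Matrix n n ℂ} (hA : A.IsHermitian) :
    (hA.eigenvectorUnitary : Matrix n n ℂ) * (hA.eigenvectorUnitary : Matrix n n ℂ)ᴴ = 1 :=
  Unitary.coe_mul_star_self hA.eigenvectorUnitary

theorem _root_.Matrix.IsHermitian.cfc_eq_ofSpectrum [DecidableEq n] {A : Matrix n n ℂ}
    (hA : A.IsHermitian) (f : ℝ → ℝ) :
    cfc f A = ofSpectrum (hA.eigenvectorUnitary : Matrix n n ℂ) (fun x => f (hA.eigenvalues x)) :=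
  hA.cfc_eq f

/-- A positive semidefinite matrix is the Gram matrix of the rows of a matrix having any prescribed
number of columns that is at least its rank. -/
theorem _root_.Matrix.PosSemidef.exists_mul_conjTranspose_eq [DecidableEq n] {A : Matrix n n ℂ}
    (hA : A.PosSemidef) {κ : Type*} [Fintype κ] (hr : A.rank ≤ Fintype.card κ) :
    ∃ V : Matrix n κ ℂ, V * Vᴴ = A := by
  classical
  set l := hA.isHermitian.eigenvalues with hl
  rw [hA.isHermitian.rank_eq_card_non_zero_eigs] at hr
  obtain ⟨g⟩ := Function.Embedding.nonempty_of_card_le hr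
  set U : Matrix n n ℂ := hA.isHermitian.eigenvectorUnitary.1 with hUdef
  -- `W` has as columns the eigenvectors of nonzero eigenvalue scaled by √λ; the isometry `J` only
  -- pads with zero columns up to `κ`.
  let W : Matrix n {i // l i ≠ 0} ℂ := of fun s i => (Real.sqrt (l i) : ℂ) * U s i
  let J : Matrix {i // l i ≠ 0} κ ℂ := of fun i k => if g i = k then 1 else 0
  refine ⟨W * J, ?_⟩
  have hJ : J * Jᴴ = 1 := by
    ext i j
    simp [J, mul_apply, one_apply, eq_comm]
  rw [conjTranspose_mul, Matrix.mul_assoc, ← Matrix.mul_assoc J, hJ, Matrix.one_mul]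
  conv_rhs => rw [hA.isHermitian.eq_ofSpectrum]
  ext s t
  rw [ofSpectrum_apply, mul_apply]
  have h1 : ∀ i : {i // l i ≠ 0}, W s i * Wᴴ i t = (l i : ℂ) * U s i * star (U t i) := by
    intro i
    have h2 : ((Real.sqrt (l i) : ℂ)) * (Real.sqrt (l i) : ℂ) = (l i : ℂ) := by
      rw [← Complex.ofReal_mul, Real.mul_self_sqrt (hA.eigenvalues_nonneg i)]
    simp only [W, of_apply, conjTranspose_apply, star_mul', RCLike.star_def, Complex.conj_ofReal]
    rw [← h2]
    ring
  refine Fintype.sum_of_injective Subtype.val Subtype.val_injective _ _ (fun i hi => ?_) h1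
  have : l i = 0 := by_contra fun h => hi ⟨⟨i, h⟩, rfl⟩
  simp [← hl, this]

omit [DecidableEq m] in
/-- A projection onto a subspace containing the range of `D`, of trace at most the number of columns
of `D`. -/
theorem exists_range_projection [DecidableEq n] (D : Matrix n m ℂ) :
    ∃ Q : Matrix n n ℂ, Q.IsHermitian ∧ Q * Q = Q ∧ Q * D = D ∧
      Q.trace.re ≤ Fintype.card m := by
  classical
  have hH : (D * Dᴴ).IsHermitian := isHermitian_mul_conjTranspose_self D
  set l := hH.eigenvalues with hl
  set U : Matrix n n ℂ := hH.eigenvectorUnitary.1 with hUdef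
  have hU : Uᴴ * U = 1 := hH.eigenvectorUnitary_conjTranspose_mul
  have hspec : D * Dᴴ = ofSpectrum U l := hH.eq_ofSpectrum
  -- The projection is the support projection of D D†; it fixes D because (Q - 1) D D† = 0 forces (Q
  -- - 1) D = 0.
  let e : n → ℝ := fun x => if l x = 0 then 0 else 1
  refine ⟨ofSpectrum U e, isHermitian_ofSpectrum _ _, ?_, ?_, ?_⟩
  · rw [ofSpectrum_mul hU]
    congr 1
    ext x
    simp [e]
  · have h0 : (ofSpectrum U e - 1) * D * Dᴴ = 0 := by
      rw [Matrix.mul_assoc, hspec, Matrix.sub_mul, ofSpectrum_mul hU, Matrix.one_mul, sub_eq_zero]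
      congr 1
      ext x
      by_cases h : l x = 0 <;> simp [e, h]
    rw [Matrix.mul_assoc, mul_self_mul_conjTranspose_eq_zero, Matrix.sub_mul, Matrix.one_mul, sub_eq_zero] at h0
    exact h0
  · rw [trace_ofSpectrum hU]
    have h1 : (∑ x, (e x : ℂ)).re = Fintype.card {x // l x ≠ 0} := by
      rw [← Complex.ofReal_sum, Complex.ofReal_re, Fintype.card_subtype]
      simp [e, Finset.sum_ite]
    rw [h1, ← hH.rank_eq_card_non_zero_eigs, rank_self_mul_conjTranspose]
    exact_mod_cast rank_le_card_width D

theorem posSemidef_one_sub_of_isHermitian_of_mul_self [DecidableEq n] {Q : Matrix n n ℂ}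
    (hQ : Q.IsHermitian) (hQ2 : Q * Q = Q) : (1 - Q).PosSemidef := by
  have h : 1 - Q = (1 - Q)ᴴ * (1 - Q) := by
    rw [conjTranspose_sub, conjTranspose_one, hQ.eq, Matrix.sub_mul, Matrix.one_mul, Matrix.mul_sub, hQ2]
    simp
  rw [h]
  exact posSemidef_conjTranspose_mul_self _

end OfSpectrum

/-! ### Parity superselection and functions of even operators -/

section Parity

open Matrix

variable {ι κ α μ : Type} [Fintype ι] [Fintype κ] [Fintype α]

theorem parity_eq_zero_or_one (s : Occ ι) : parity s = 0 ∨ parity s = 1 := by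
  generalize parity s = a
  revert a
  decide

theorem IsEvenOp.conjTranspose {X : FockHom ι κ} (h : IsEvenOp X) : IsEvenOp (ι := κ) (κ := ι) Xᴴ :=
  fun s t hst => by rw [conjTranspose_apply, h t s (Ne.symm hst), star_zero]

variable [DecidableEq ι] [DecidableEq κ]

/-- The parity superselection operator `(-1)^n`. -/
noncomputable def parityOp (ι : Type) [Fintype ι] [DecidableEq ι] : FockOp ι :=
  diagonal fun s => if parity s = 0 then 1 else -1

/-- Between sectors of different parity the commutator with (-1)^n multiplies an entry by ±2, and
within a sector by 0. Commutation, unlike the entrywise definition, is stable under a change of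
basis. -/
theorem isEvenOp_iff_commute (X : FockOp ι) : IsEvenOp X ↔ parityOp ι * X = X * parityOp ι := by
  rw [← Matrix.ext_iff]
  refine forall₂_congr fun s t => ?_
  rw [parityOp, diagonal_mul, mul_diagonal]
  rcases parity_eq_zero_or_one s with hs | hs <;> rcases parity_eq_zero_or_one t with ht | ht <;>
    simp [hs, ht, neg_eq_iff_add_eq_zero, eq_neg_iff_add_eq_zero, ← two_mul]

/-- Functions of an even Hermitian operator are even. -/
theorem isEvenOp_ofSpectrum {m : Type*} [Fintype m] [DecidableEq m] {U : Matrix (Occ ι) m ℂ}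
    (hU : Uᴴ * U = 1) (hU' : U * Uᴴ = 1) {p : m → ℝ} (h : IsEvenOp (ofSpectrum U p))
    {q : m → ℝ} (hq : ∀ x y, p x = p y → q x = q y) : IsEvenOp (ofSpectrum U q) := by
  rw [isEvenOp_iff_commute] at h ⊢
  set Θ := parityOp ι
  set G := Uᴴ * Θ * U with hG
  have key : ∀ r : m → ℝ, Uᴴ * (Θ * ofSpectrum U r) * U = G * diagonal (fun x => (r x : ℂ)) ∧
      Uᴴ * (ofSpectrum U r * Θ) * U = diagonal (fun x => (r x : ℂ)) * G := by
    intro r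
    constructor
    · have : Uᴴ * (Θ * ofSpectrum U r) * U =
        Uᴴ * Θ * U * diagonal (fun x => (r x : ℂ)) * (Uᴴ * U) := by
        simp only [ofSpectrum, Matrix.mul_assoc]
      rw [this, hU, Matrix.mul_one]
    · have : Uᴴ * (ofSpectrum U r * Θ) * U =
        (Uᴴ * U) * diagonal (fun x => (r x : ℂ)) * (Uᴴ * Θ * U) := by
        simp only [ofSpectrum, Matrix.mul_assoc]
      rw [this, hU, Matrix.one_mul]
  have h1 : G * diagonal (fun x => (p x : ℂ)) = diagonal (fun x => (p x : ℂ)) * G := by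
    rw [← (key p).1, h, (key p).2]
  -- Commuting with diag(p) means that `G` vanishes between different values of p; where p agrees so
  -- does q, hence `G` commutes with diag(q) too.
  have h2 : G * diagonal (fun x => (q x : ℂ)) = diagonal (fun x => (q x : ℂ)) * G := by
    ext x y
    have := congrFun (congrFun h1 x) y
    rw [mul_diagonal, diagonal_mul] at this ⊢
    by_cases hxy : p x = p y
    · rw [hq x y hxy, mul_comm]
    · have h3 : ((p y : ℂ) - p x) * G x y = 0 := by linear_combination this
      have h4 : (p y : ℂ) - p x ≠ 0 := sub_ne_zero.mpr fun h => hxy (by exact_mod_cast h.symm)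
      rw [(mul_eq_zero.mp h3).resolve_left h4]
      ring
  have h3 : Uᴴ * (Θ * ofSpectrum U q) * U = Uᴴ * (ofSpectrum U q * Θ) * U := by
    rw [(key q).1, h2, (key q).2]
  have h4 : ∀ X : FockOp ι, U * (Uᴴ * X * U) * Uᴴ = X := fun X => by
    have : U * (Uᴴ * X * U) * Uᴴ = (U * Uᴴ) * X * (U * Uᴴ) := by simp only [Matrix.mul_assoc]
    rw [this, hU', Matrix.one_mul, Matrix.mul_one]
  rw [← h4 (Θ * _), h3, h4]

/-- The square root is a function of `A`, hence even. It yields the canonical purification, the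
completion of a contraction to a channel, and the factorization of ρ used in Cauchy–Schwarz. -/
theorem exists_isEvenOp_mul_conjTranspose_eq {A : FockOp ι} (hA : A.PosSemidef) (he : IsEvenOp A) :
    ∃ B : FockOp ι, IsEvenOp B ∧ B.IsHermitian ∧ B * B = A := by
  have hH := hA.isHermitian
  refine ⟨ofSpectrum hH.eigenvectorUnitary fun x => Real.sqrt (hH.eigenvalues x), ?_,
    isHermitian_ofSpectrum _ _, ?_⟩
  · refine isEvenOp_ofSpectrum hH.eigenvectorUnitary_conjTranspose_mul
      hH.eigenvectorUnitary_mul_conjTranspose (p := hH.eigenvalues) ?_ fun x y h => by rw [h]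
    rw [← hH.eq_ofSpectrum]
    exact he
  · rw [ofSpectrum_mul hH.eigenvectorUnitary_conjTranspose_mul]
    conv_rhs => rw [hH.eq_ofSpectrum]
    congr 1
    ext x
    exact Real.mul_self_sqrt (hA.eigenvalues_nonneg x)

end Parity

/-! ### Entanglement fidelity in terms of Kraus operators -/

section Fidelity

open Matrix

variable {ι κ α : Type} [Fintype ι] [Fintype κ] [Fintype α]
  [DecidableEq ι] [DecidableEq κ] [DecidableEq α]

theorem sqrtOp_mul_self {B : FockOp ι} (hB : B.PosSemidef) : sqrtOp (B * B) = B := by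
  have hH := hB.isHermitian
  have hsa : IsSelfAdjoint B := hH
  rw [sqrtOp, ← pow_two, ← cfc_comp_pow Real.sqrt 2 B
    (Real.continuous_sqrt.continuousOn) hsa]
  conv_rhs => rw [hH.eq_ofSpectrum]
  rw [hH.cfc_eq_ofSpectrum]
  congr 1
  ext x
  exact Real.sqrt_sq (hB.eigenvalues_nonneg x)

/-- The fidelity of a pure state with a mixture of vectors. -/
theorem uhlmannFidelity_vecMulVec_sq {v : Occ ι → ℂ} (hv : star v ⬝ᵥ v = 1) {m : Type*} [Fintype m]
    (y : m → Occ ι → ℂ) :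
    uhlmannFidelity (vecMulVec v (star v)) (∑ i, vecMulVec (y i) (star (y i))) ^ 2 =
      ∑ i, ‖star v ⬝ᵥ y i‖ ^ 2 := by
  set Φ := vecMulVec v (star v) with hΦ
  have hpos : Φ.PosSemidef := posSemidef_vecMulVec_self_star v
  have hmul : Φ * Φ = Φ := by
    rw [hΦ, vecMulVec_mul_vecMulVec, hv, one_smul]
  have hsqrt : sqrtOp Φ = Φ := by
    conv_lhs => rw [← hmul]
    exact sqrtOp_mul_self hpos
  set c : ℝ := ∑ i, ‖star v ⬝ᵥ y i‖ ^ 2 with hc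
  have hc0 : 0 ≤ c := Finset.sum_nonneg fun i _ => by positivity
  -- Sandwiching by a rank-one projection gives a multiple of it, so the square root in the fidelity
  -- is explicit.
  have hsand : Φ * (∑ i, vecMulVec (y i) (star (y i))) * Φ = (c : ℂ) • Φ := by
    rw [Finset.mul_sum, Finset.sum_mul, hc, Complex.ofReal_sum, Finset.sum_smul]
    refine Finset.sum_congr rfl fun i _ => ?_
    have h1 : star (y i) ⬝ᵥ v = star (star v ⬝ᵥ y i) := by
      rw [star_dotProduct]
    rw [hΦ, vecMulVec_mul_vecMulVec, vecMulVec_mul_vecMulVec, smul_dotProduct, h1]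
    ext s t
    simp only [vecMulVec_apply, Matrix.smul_apply, Pi.smul_apply, smul_eq_mul, Complex.ofReal_pow]
    rw [← Complex.mul_conj']
    simp only [RCLike.star_def]
    ring
  have hfac : (c : ℂ) • Φ = ((Real.sqrt c : ℂ) • Φ) * ((Real.sqrt c : ℂ) • Φ) := by
    rw [Matrix.smul_mul, Matrix.mul_smul, smul_smul, hmul, ← Complex.ofReal_mul,
      Real.mul_self_sqrt hc0]
  have htr : Φ.trace = 1 := by rw [hΦ, trace_vecMulVec, dotProduct_comm, hv]
  rw [uhlmannFidelity, hsqrt, hsand, hfac, sqrtOp_mul_self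
    (hpos.smul (by simp)), trace_smul, htr]
  simp [Real.sq_sqrt hc0]

omit [DecidableEq ι] [DecidableEq α] in
theorem sum_occ_sum {M : Type*} [AddCommMonoid M] [DecidableEq ι] [DecidableEq α]
    (f : Occ (ι ⊕ α) → M) :
    ∑ u, f u = ∑ s : Occ ι, ∑ a : Occ α, f (Sum.elim s a) := by
  rw [← Fintype.sum_prod_type']
  exact ((Equiv.sumArrowEquivProdArrow ι α (ZMod 2)).symm.sum_comp f).symm

omit [Fintype κ] [DecidableEq κ] [Fintype α] [DecidableEq α] in
-- The vectors on the right are (C i ⊗ 1) v: for each occupation of the ancilla, C i acts on the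
-- corresponding slice of v.
theorem extendChannel_vecMulVec {m : Type*} [Fintype m] {T : FockOp ι →ₗ[ℂ] FockOp κ}
    {C : m → FockHom ι κ} (hT : ∀ X, T X = ∑ i, C i * X * (C i)ᴴ) (v : Occ (ι ⊕ α) → ℂ) :
    extendChannel α T (vecMulVec v (star v)) =
      ∑ i, vecMulVec
        (fun u => (C i *ᵥ fun s => v (Sum.elim s fun a => u (Sum.inr a))) fun k => u (Sum.inl k))
        (star fun u =>
          (C i *ᵥ fun s => v (Sum.elim s fun a => u (Sum.inr a))) fun k => u (Sum.inl k)) := by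
  ext u w
  rw [extendChannel, of_apply, hT, Matrix.sum_apply, Matrix.sum_apply]
  refine Finset.sum_congr rfl fun i _ => ?_
  set a : Occ ι → ℂ := fun s => v (Sum.elim s fun a => u (Sum.inr a))
  set b : Occ ι → ℂ := fun s => v (Sum.elim s fun a => w (Sum.inr a))
  have h : (of fun s t => vecMulVec v (star v) (Sum.elim s fun a => u (Sum.inr a))
      (Sum.elim t fun a => w (Sum.inr a)) : FockOp ι) = vecMulVec a (star b) := by
    ext s t
    rfl
  rw [h, mul_vecMulVec, vecMulVec_mul, ← star_mulVec]
  rfl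

/-- For a map with Kraus operators `C i`, the entanglement fidelity is `∑ |Tr (ρ C i)|²`. -/
theorem isEntanglementFidelity_of_kraus {ρ : FockOp ι} (hρ : IsNormalizedState ρ)
    {m : Type*} [Fintype m] {T : FockOp ι →ₗ[ℂ] FockOp ι}
    {C : m → FockHom ι ι} (hT : ∀ X, T X = ∑ i, C i * X * (C i)ᴴ) :
    IsEntanglementFidelity ρ T (∑ i, ‖(ρ * C i).trace‖ ^ 2) := by
  constructor
  · obtain ⟨B, hBe, hBh, hB⟩ := exists_isEvenOp_mul_conjTranspose_eq hρ.posSemidef hρ.even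
    let e := Fintype.equivFin ι
    -- Canonical purification: the entries of √ρ read as a vector, with as many ancillary modes as
    -- system modes. Since √ρ is even, the two halves have equal parity wherever v is nonzero, so v
    -- lies in the even sector.
    let v : Occ (ι ⊕ Fin (Fintype.card ι)) → ℂ := fun u =>
      B (fun i => u (Sum.inl i)) (fun i => u (Sum.inr (e i)))
    have hpt : fermionicPartialTrace (vecMulVec v (star v)) = ρ := by
      ext s t
      rw [← hB, mul_apply, fermionicPartialTrace, of_apply,
        ← (Equiv.arrowCongr e (Equiv.refl (ZMod 2))).sum_comp]
      refine Finset.sum_congr rfl fun a _ => ?_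
      rw [← hBh.apply a t]
      simp [v, vecMulVec_apply, Equiv.arrowCongr, Function.comp_def]
    have hpar : ∀ u, v u ≠ 0 → parity u = 0 := by
      intro u hu
      have h1 := not_imp_comm.mp (hBe _ _) hu
      have h2 : ∑ i, u (Sum.inr (e i)) = ∑ j, u (Sum.inr j) :=
        e.sum_comp fun j => u (Sum.inr j)
      simp only [parity] at h1 ⊢
      rw [Fintype.sum_sum_type, h1, h2]
      exact CharTwo.add_self_eq_zero _
    refine ⟨Fintype.card ι, vecMulVec v (star v),
      ⟨posSemidef_vecMulVec_self_star v, ?_, ?_⟩, ⟨v, rfl⟩, hpt⟩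
    · intro s t hst
      rw [vecMulVec_apply]
      by_cases hs : v s = 0
      · rw [hs, zero_mul]
      · by_cases ht : v t = 0
        · rw [Pi.star_apply, ht, star_zero, mul_zero]
        · exact absurd ((hpar s hs).trans (hpar t ht).symm) hst
    · rw [← hρ.trace_eq_one, ← hpt, trace, trace, sum_occ_sum]
      rfl
  · rintro K Φ ⟨hΦ, ⟨v, rfl⟩, hm⟩
    have hv : star v ⬝ᵥ v = 1 := by
      rw [← hΦ.trace_eq_one, trace_vecMulVec, dotProduct_comm]
    rw [extendChannel_vecMulVec hT, uhlmannFidelity_vecMulVec_sq hv]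
    refine Finset.sum_congr rfl fun i _ => ?_
    -- It remains to see that ⟨v, (C i ⊗ 1) v⟩ = Tr(ρ C i): summing over the ancilla rebuilds the
    -- marginal.
    congr 2
    rw [dotProduct, sum_occ_sum, trace_mul_comm, trace]
    refine Finset.sum_congr rfl fun s _ => ?_
    simp only [Pi.star_apply, Sum.elim_inl, Sum.elim_inr, mulVec, dotProduct, diag_apply, mul_apply,
      Finset.mul_sum]
    rw [Finset.sum_comm]
    refine Finset.sum_congr rfl fun t _ => ?_
    rw [← hm, fermionicPartialTrace, of_apply, Finset.mul_sum]
    refine Finset.sum_congr rfl fun a _ => ?_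
    rw [vecMulVec_apply, Pi.star_apply]
    ring

end Fidelity

/-! ### Completing an even contraction to a fermionic channel -/

section Channel

open Matrix

variable {ι κ : Type} [Fintype ι] [Fintype κ] [DecidableEq ι] [DecidableEq κ]

/-- An even contraction is a Kraus operator of some fermionic channel. -/
theorem exists_isFermionicChannel_of_contraction {W : FockHom ι κ} (hW : IsEvenOp W)
    (hW' : (1 - Wᴴ * W).PosSemidef) :
    ∃ (T : FockOp ι →ₗ[ℂ] FockOp κ) (n : ℕ) (C : Fin n → FockHom ι κ) (i₀ : Fin n),
      IsFermionicChannel T ∧ (∀ X, T X = ∑ i, C i * X * (C i)ᴴ) ∧ C i₀ = W := by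
  have heven : IsEvenOp (1 - Wᴴ * W) := by
    intro s t hst
    rw [Matrix.sub_apply, one_apply_ne (fun h => hst (by rw [h])), mul_apply, zero_sub,
      neg_eq_zero]
    refine Finset.sum_eq_zero fun k _ => ?_
    by_cases hk : parity k = parity t
    · rw [conjTranspose_apply, hW k s (fun h => hst (h.symm.trans hk)), star_zero, zero_mul]
    · rw [hW k t hk, mul_zero]
  obtain ⟨B, hBe, hBh, hB⟩ := exists_isEvenOp_mul_conjTranspose_eq hW' heven
  -- The missing weight 1 - W†W = B² is sent to the vacuum by the operators |0⟩⟨s|B. As B is even,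
  -- each of them has a definite parity, that of s.
  let D : Option (Occ ι) → FockHom ι κ := fun o =>
    o.elim W fun s => single (0 : Occ κ) s (1 : ℂ) * B
  let e := Fintype.equivFin (Option (Occ ι))
  let C : Fin (Fintype.card (Option (Occ ι))) → FockHom ι κ := fun i => D (e.symm i)
  let T : FockOp ι →ₗ[ℂ] FockOp κ :=
    { toFun := fun X => ∑ i, C i * X * (C i)ᴴ
      map_add' := fun X Y => by
        simp only [Matrix.mul_add, Matrix.add_mul, Finset.sum_add_distrib]
      map_smul' := fun c X => by
        simp only [Matrix.mul_smul, Matrix.smul_mul, Finset.smul_sum, RingHom.id_apply] }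
  refine ⟨T, _, C, e none, ⟨_, C, fun i => ?_, ?_, fun X => rfl⟩, fun X => rfl, ?_⟩
  · change IsEvenOp (D (e.symm i)) ∨ IsOddOp (D (e.symm i))
    cases e.symm i with
    | none => exact Or.inl hW
    | some s =>
      have h0 : ∀ k t, k ≠ 0 → D (some s) k t = 0 := fun k t hk =>
        single_mul_apply_of_ne _ _ _ _ _ hk _
      have h1 : ∀ t, D (some s) 0 t = B s t := fun t => by
        simp [D]
      by_cases hs : parity s = parity (0 : Occ κ)
      · refine Or.inl fun k t hkt => ?_
        by_cases hk : k = 0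
        · subst hk
          rw [h1]
          exact hBe _ _ (hs ▸ hkt)
        · exact h0 k t hk
      · refine Or.inr fun k t hkt => ?_
        by_cases hk : k = 0
        · subst hk
          rw [h1]
          exact hBe _ _ (hkt ▸ hs)
        · exact h0 k t hk
  · have h1 : ∀ s : Occ ι, (D (some s))ᴴ * D (some s) = B * single s s (1 : ℂ) * B := by
      intro s
      simp only [D, Option.elim_some, conjTranspose_mul, conjTranspose_single, star_one, hBh.eq]
      rw [Matrix.mul_assoc, ← Matrix.mul_assoc (single s 0 1), single_mul_single_same, one_mul,
        Matrix.mul_assoc]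
    change ∑ i, (D (e.symm i))ᴴ * D (e.symm i) = 1
    rw [e.symm.sum_comp fun o => (D o)ᴴ * D o, Fintype.sum_option]
    simp only [h1]
    rw [← Finset.sum_mul, ← Finset.mul_sum]
    have h2 : ∑ s : Occ ι, single s s (1 : ℂ) = (1 : FockOp ι) := by
      ext s t
      simp [Matrix.sum_apply, single_apply, one_apply, ite_and]
    rw [h2, Matrix.mul_one, hB]
    simp [D]
  · simp [C, D]

end Channel

/-! ### Typical sequences and the weak law of large numbers -/

section Typical

variable {α : Type*}

/-- Sequences of positive probability whose empirical entropy rate is within `ε` of `H`. -/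
def IsTypical (p : α → ℝ) (H ε : ℝ) {N : ℕ} (x : Fin N → α) : Prop :=
  0 < ∏ j, p (x j) ∧ |1 / (N : ℝ) * Real.logb 2 (1 / ∏ j, p (x j)) - H| ≤ ε

theorem IsTypical.bounds {p : α → ℝ} {H ε : ℝ} {N : ℕ} (hN : 0 < N) {x : Fin N → α}
    (hx : IsTypical p H ε x) :
    (2 : ℝ) ^ (-((N : ℝ) * (H + ε))) ≤ ∏ j, p (x j) ∧
      ∏ j, p (x j) ≤ (2 : ℝ) ^ (-((N : ℝ) * (H - ε))) := by
  obtain ⟨h0, h⟩ := hx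
  have hN' : (0 : ℝ) < N := by exact_mod_cast hN
  rw [one_div (∏ j, p (x j)), Real.logb_inv, abs_le] at h
  set l := Real.logb 2 (∏ j, p (x j))
  have e : (N : ℝ) * (1 / (N : ℝ) * -l) = -l := by field_simp
  constructor
  · rw [← Real.le_logb_iff_rpow_le one_lt_two h0]
    nlinarith [mul_le_mul_of_nonneg_left h.2 hN'.le]
  · rw [← Real.logb_le_iff_le_rpow one_lt_two h0]
    nlinarith [mul_le_mul_of_nonneg_left h.1 hN'.le]

variable [Fintype α]

theorem sum_pi_prod_eq_one {p : α → ℝ} (h1 : ∑ a, p a = 1) (N : ℕ) :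
    ∑ x : Fin N → α, ∏ j, p (x j) = 1 := by
  classical
  rw [← Fintype.sum_pow, h1, one_pow]

theorem sum_pi_succ {M : Type*} [AddCommMonoid M] {N : ℕ} (f : (Fin (N + 1) → α) → M) :
    ∑ x, f x = ∑ a, ∑ y : Fin N → α, f (Fin.cons a y) := by
  rw [← Fintype.sum_prod_type']
  exact ((Fin.consEquiv fun _ => α).sum_comp f).symm

/-- The first two moments of a sum of independent centred variables. -/
theorem sum_pi_prod_mul_moments {p g : α → ℝ} (h1 : ∑ a, p a = 1) (hg : ∑ a, p a * g a = 0)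
    (N : ℕ) :
    ∑ x : Fin N → α, (∏ j, p (x j)) * ∑ j, g (x j) = 0 ∧
      ∑ x : Fin N → α, (∏ j, p (x j)) * (∑ j, g (x j)) ^ 2 = N * ∑ a, p a * g a ^ 2 := by
  induction N with
  | zero => simp
  | succ N ih =>
    have h0 := sum_pi_prod_eq_one h1 N
    rw [sum_pi_succ, sum_pi_succ]
    simp only [Fin.prod_univ_succ, Fin.sum_univ_succ, Fin.cons_zero, Fin.cons_succ]
    constructor
    · have : ∀ a, ∑ y : Fin N → α, p a * (∏ j, p (y j)) * (g a + ∑ j, g (y j)) = p a * g a := by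
        intro a
        calc _ = ∑ y : Fin N → α, ((p a * g a) * (∏ j, p (y j)) +
              p a * ((∏ j, p (y j)) * ∑ j, g (y j))) := Finset.sum_congr rfl fun y _ => by ring
          _ = _ := by
            rw [Finset.sum_add_distrib, ← Finset.mul_sum, ← Finset.mul_sum, h0, ih.1]
            ring
      rw [Finset.sum_congr rfl fun a _ => this a, hg]
    · have : ∀ a, ∑ y : Fin N → α, p a * (∏ j, p (y j)) * (g a + ∑ j, g (y j)) ^ 2 =
          p a * g a ^ 2 + p a * (N * ∑ a, p a * g a ^ 2) := by
        intro a
        calc _ = ∑ y : Fin N → α, ((p a * g a ^ 2) * (∏ j, p (y j)) +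
              (2 * p a * g a) * ((∏ j, p (y j)) * ∑ j, g (y j)) +
              p a * ((∏ j, p (y j)) * (∑ j, g (y j)) ^ 2)) :=
            Finset.sum_congr rfl fun y _ => by ring
          _ = _ := by
            rw [Finset.sum_add_distrib, Finset.sum_add_distrib, ← Finset.mul_sum, ← Finset.mul_sum,
              ← Finset.mul_sum, h0, ih.1, ih.2]
            ring
      rw [Finset.sum_congr rfl fun a _ => this a, Finset.sum_add_distrib, ← Finset.sum_mul, h1]
      push_cast
      ring

open Classical in
/-- The weak law of large numbers: nontypical sequences have small probability. -/
theorem sum_not_isTypical_le {p : α → ℝ} (h0 : ∀ a, 0 ≤ p a) (h1 : ∑ a, p a = 1) {H : ℝ}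
    (hH : H = -∑ a, p a * Real.logb 2 (p a)) {ε : ℝ} (hε : 0 < ε) {N : ℕ} (hN : 0 < N) :
    ∑ x : Fin N → α, (if IsTypical p H ε x then 0 else ∏ j, p (x j)) ≤
      (∑ a, p a * (-Real.logb 2 (p a) - H) ^ 2) / ε ^ 2 / N := by
  have hN' : (0 : ℝ) < N := by exact_mod_cast hN
  set g : α → ℝ := fun a => -Real.logb 2 (p a) - H with hg
  have hg0 : ∑ a, p a * g a = 0 := by
    simp only [hg, mul_sub, mul_neg, Finset.sum_sub_distrib, Finset.sum_neg_distrib,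
      ← Finset.sum_mul, h1]
    rw [hH]
    ring
  -- Chebyshev's inequality, pointwise: an atypical sequence of positive probability has |∑ g| > Nε.
  -- Sequences of probability zero are treated apart, since the logarithm of the product splits only
  -- for nonzero factors.
  have key : ∀ x : Fin N → α, (if IsTypical p H ε x then 0 else ∏ j, p (x j)) ≤
      (∏ j, p (x j)) * (∑ j, g (x j)) ^ 2 / (N ^ 2 * ε ^ 2) := by
    intro x
    have hp : 0 ≤ ∏ j, p (x j) := Finset.prod_nonneg fun j _ => h0 _
    split_ifs with h
    · positivity
    rcases hp.eq_or_lt with hz | hpos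
    · rw [← hz]
      simp
    have hne : ∀ j ∈ Finset.univ, p (x j) ≠ 0 := Finset.prod_ne_zero_iff.mp hpos.ne'
    have hlog : 1 / (N : ℝ) * Real.logb 2 (1 / ∏ j, p (x j)) - H = (∑ j, g (x j)) / N := by
      rw [one_div (∏ j, p (x j)), Real.logb_inv, Real.logb_prod _ _ hne]
      simp only [hg, Finset.sum_sub_distrib, Finset.sum_neg_distrib, Finset.sum_const,
        Finset.card_univ, Fintype.card_fin, nsmul_eq_mul]
      field_simp
    have hlt : ε < |(∑ j, g (x j)) / N| := by
      rw [← hlog]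
      exact not_le.mp fun hle => h ⟨hpos, hle⟩
    have hsq : N ^ 2 * ε ^ 2 ≤ (∑ j, g (x j)) ^ 2 := by
      have := pow_le_pow_left₀ hε.le hlt.le 2
      rw [sq_abs, div_pow, le_div_iff₀ (by positivity)] at this
      linarith
    rw [le_div_iff₀ (by positivity)]
    exact mul_le_mul_of_nonneg_left hsq hp
  refine (Finset.sum_le_sum fun x _ => key x).trans (le_of_eq ?_)
  rw [← Finset.sum_div, (sum_pi_prod_mul_moments h1 hg0 N).2]
  field_simp
  rfl

open Classical in
-- Each typical sequence has probability at least 2^(-N(H+ε)), and the probabilities sum to at most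
-- 1.
theorem card_isTypical_le {p : α → ℝ} (h0 : ∀ a, 0 ≤ p a) (h1 : ∑ a, p a = 1) (H ε : ℝ) {N : ℕ}
    (hN : 0 < N) :
    (Fintype.card {x : Fin N → α // IsTypical p H ε x} : ℝ) ≤ (2 : ℝ) ^ ((N : ℝ) * (H + ε)) := by
  have hsum : ∑ x : {x : Fin N → α // IsTypical p H ε x}, (2 : ℝ) ^ (-((N : ℝ) * (H + ε))) ≤ 1 := by
    rw [← sum_pi_prod_eq_one h1 N]
    refine (Finset.sum_le_sum fun x _ => (x.2.bounds hN).1).trans ?_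
    rw [← Finset.sum_subtype (Finset.univ.filter fun x : Fin N → α => IsTypical p H ε x) (by simp)
      fun x => ∏ j, p (x j)]
    exact Finset.sum_le_univ_sum_of_nonneg fun x => Finset.prod_nonneg fun j _ => h0 _
  rw [Finset.sum_const, Finset.card_univ, nsmul_eq_mul, Real.rpow_neg two_pos.le,
    ← div_eq_mul_inv, div_le_one (by positivity)] at hsum
  exact hsum

end Typical

/-! ### Dimensions of Fock spaces and of their sectors -/

section Occupations

theorem card_occ (M : ℕ) : Fintype.card (Occ (Fin M)) = 2 ^ M := by
  simp [Occ, ZMod.card]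

/-- Each sector of a Fock space of `M + 1` modes has dimension at least `2 ^ M`. -/
theorem two_pow_le_card_sector (M : ℕ) (c : ZMod 2) :
    2 ^ M ≤ Fintype.card {k : Occ (Fin (M + 1)) // parity k = c} := by
  rw [← card_occ]
  refine Fintype.card_le_of_injective
    -- The first mode is a parity bit that corrects the total parity to c.
    (fun k => ⟨Fin.cons (c - parity k) k, by simp [parity, Fin.sum_univ_succ]⟩) fun k l h => ?_
  have h' : (Fin.cons (c - parity k) k : Occ (Fin (M + 1))) = Fin.cons (c - parity l) l :=
    Subtype.ext_iff.mp h
  exact (Fin.cons_injective2 h').2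

end Occupations

/-! ### Spectrum of the tensor power and the typical projector -/

section ParallelPower

open Matrix

/-- The columns of the tensor power of `U` are the products of columns of `U`. -/
def tensorPowerColumns {ι : Type} {m : Type*} (U : Matrix (Occ ι) m ℂ) (N : ℕ) :
    Matrix (Occ (Fin N × ι)) (Fin N → m) ℂ :=
  of fun u x => ∏ j, U (fun i => u (j, i)) (x j)

variable {ι : Type}

theorem parallelPower_ofSpectrum {m : Type*} [Fintype m] [DecidableEq m] (U : Matrix (Occ ι) m ℂ)
    (p : m → ℝ) (N : ℕ) :
    parallelPower (ofSpectrum U p) N =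
      ofSpectrum (tensorPowerColumns U N) fun x => ∏ j, p (x j) := by
  ext s t
  rw [parallelPower, of_apply, ofSpectrum_apply]
  simp only [ofSpectrum_apply]
  rw [Finset.prod_univ_sum, Fintype.piFinset_univ]
  refine Finset.sum_congr rfl fun x _ => ?_
  rw [Finset.prod_mul_distrib, Finset.prod_mul_distrib]
  simp [tensorPowerColumns]

theorem parallelPower_one [DecidableEq ι] [Fintype ι] (N : ℕ) :
    parallelPower (1 : FockOp ι) N = 1 := by
  ext s t
  rw [parallelPower, of_apply]
  by_cases h : s = t
  · subst h
    simp
  · rw [one_apply_ne h]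
    obtain ⟨⟨j, i⟩, hji⟩ := Function.ne_iff.mp h
    refine Finset.prod_eq_zero (Finset.mem_univ j) (one_apply_ne fun h' => hji ?_)
    exact congrFun h' i

variable [Fintype ι] [DecidableEq ι]

theorem tensorPowerColumns_mul_conjTranspose {m : Type*} [Fintype m] [DecidableEq m]
    {U : Matrix (Occ ι) m ℂ} (hU : U * Uᴴ = 1) (N : ℕ) :
    tensorPowerColumns U N * (tensorPowerColumns U N)ᴴ = 1 := by
  -- With all eigenvalues equal to 1, the tensor power of the identity is the claim.
  have h := parallelPower_ofSpectrum U (fun _ => 1) N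
  rw [ofSpectrum_one hU, parallelPower_one] at h
  simpa [ofSpectrum] using h.symm

theorem tensorPowerColumns_conjTranspose_mul {m : Type*} [DecidableEq m]
    {U : Matrix (Occ ι) m ℂ} (hU : Uᴴ * U = 1) (N : ℕ) :
    (tensorPowerColumns U N)ᴴ * tensorPowerColumns U N = 1 := by
  ext x y
  rw [mul_apply]
  have h1 : ∑ u, (tensorPowerColumns U N)ᴴ x u * tensorPowerColumns U N u y =
      ∑ w : Fin N → Occ ι, ∏ j, star (U (w j) (x j)) * U (w j) (y j) := by
    rw [← (Equiv.curry (Fin N) ι (ZMod 2)).sum_comp]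
    refine Finset.sum_congr rfl fun u _ => ?_
    rw [Finset.prod_mul_distrib]
    simp only [tensorPowerColumns, conjTranspose_apply, of_apply, star_prod]
    rfl
  have h2 : ∏ j, ∑ s, star (U s (x j)) * U s (y j) =
      ∑ w : Fin N → Occ ι, ∏ j, star (U (w j) (x j)) * U (w j) (y j) := by
    rw [Finset.prod_univ_sum, Fintype.piFinset_univ]
  have h3 : ∀ a b, ∑ s, star (U s a) * U s b = (1 : Matrix m m ℂ) a b := fun a b => by
    rw [← hU, mul_apply]
    rfl
  rw [h1, ← h2]
  simp only [h3]
  by_cases h : x = y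
  · subst h
    simp
  · rw [one_apply_ne h]
    obtain ⟨j, hj⟩ := Function.ne_iff.mp h
    exact Finset.prod_eq_zero (Finset.mem_univ j) (one_apply_ne hj)

theorem IsNormalizedState.eigenvalues_sum {ρ : FockOp ι} (hρ : IsNormalizedState ρ) :
    ∑ x, hρ.posSemidef.isHermitian.eigenvalues x = 1 := by
  have h := hρ.trace_eq_one
  rw [hρ.posSemidef.isHermitian.eq_ofSpectrum,
    trace_ofSpectrum hρ.posSemidef.isHermitian.eigenvectorUnitary_conjTranspose_mul,
    ← Complex.ofReal_sum] at h
  exact_mod_cast h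

theorem parallelPower_eq_ofSpectrum {ρ : FockOp ι} (hρ : ρ.IsHermitian) (N : ℕ) :
    parallelPower ρ N = ofSpectrum (tensorPowerColumns hρ.eigenvectorUnitary.1 N)
      fun x => ∏ j, hρ.eigenvalues (x j) := by
  conv_lhs => rw [hρ.eq_ofSpectrum]
  exact parallelPower_ofSpectrum _ _ N

theorem IsNormalizedState.parallelPower {ρ : FockOp ι} (hρ : IsNormalizedState ρ) (N : ℕ) :
    IsNormalizedState (parallelPower ρ N) where
  posSemidef := by
    rw [parallelPower_eq_ofSpectrum hρ.posSemidef.isHermitian]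
    exact posSemidef_ofSpectrum _ fun x =>
      Finset.prod_nonneg fun j _ => hρ.posSemidef.eigenvalues_nonneg _
  even := fun s t hst => by
    simp only [parity, Fintype.sum_prod_type] at hst
    obtain ⟨j, hj⟩ : ∃ j, ∑ i, s (j, i) ≠ ∑ i, t (j, i) := by
      by_contra! h
      exact hst (Finset.sum_congr rfl fun j _ => h j)
    exact Finset.prod_eq_zero (Finset.mem_univ j) (hρ.even _ _ hj)
  trace_eq_one := by
    rw [parallelPower_eq_ofSpectrum hρ.posSemidef.isHermitian, trace_ofSpectrum
      (tensorPowerColumns_conjTranspose_mul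
        hρ.posSemidef.isHermitian.eigenvectorUnitary_conjTranspose_mul N), ← Complex.ofReal_sum,
      sum_pi_prod_eq_one hρ.eigenvalues_sum, Complex.ofReal_one]

theorem fermionicEntropy_eq {ρ : FockOp ι} (hρ : ρ.IsHermitian) :
    fermionicEntropy ρ = -∑ x, hρ.eigenvalues x * Real.logb 2 (hρ.eigenvalues x) := by
  have h : ρ * log2Op ρ = ofSpectrum hρ.eigenvectorUnitary.1
      fun x => hρ.eigenvalues x * Real.logb 2 (hρ.eigenvalues x) := by
    rw [log2Op, hρ.cfc_eq_ofSpectrum,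
      ← ofSpectrum_mul hρ.eigenvectorUnitary_conjTranspose_mul, ← hρ.eq_ofSpectrum]
  rw [fermionicEntropy, h, trace_ofSpectrum hρ.eigenvectorUnitary_conjTranspose_mul,
    ← Complex.ofReal_sum, Complex.ofReal_re]

open Classical in
theorem typicalProjector_eq_ofSpectrum {ρ : FockOp ι} (hρ : ρ.IsHermitian) (N : ℕ) (ε : ℝ) :
    typicalProjector ρ hρ N ε = ofSpectrum (tensorPowerColumns hρ.eigenvectorUnitary.1 N)
      fun x => if IsTypical hρ.eigenvalues (fermionicEntropy ρ) ε x then 1 else 0 := by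
  ext s t
  rw [ofSpectrum_apply, typicalProjector, Matrix.sum_apply]
  refine Finset.sum_congr rfl fun x _ => ?_
  by_cases h : IsTypical hρ.eigenvalues (fermionicEntropy ρ) ε x
  · rw [if_pos h, Complex.ofReal_one, one_mul]
    exact congrArg (fun X : FockOp (Fin N × ι) => X s t) (if_pos h)
  · rw [if_neg h, Complex.ofReal_zero, zero_mul, zero_mul]
    exact congrArg (fun X : FockOp (Fin N × ι) => X s t) (if_neg h)

open Classical in
theorem typicalProjector_mul_self {ρ : FockOp ι} (hρ : ρ.IsHermitian) (N : ℕ) (ε : ℝ) :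
    typicalProjector ρ hρ N ε * typicalProjector ρ hρ N ε = typicalProjector ρ hρ N ε := by
  rw [typicalProjector_eq_ofSpectrum, ofSpectrum_mul
    (tensorPowerColumns_conjTranspose_mul hρ.eigenvectorUnitary_conjTranspose_mul N)]
  congr 1
  ext x
  simp

theorem isHermitian_typicalProjector {ρ : FockOp ι} (hρ : ρ.IsHermitian) (N : ℕ) (ε : ℝ) :
    (typicalProjector ρ hρ N ε).IsHermitian := by
  rw [typicalProjector_eq_ofSpectrum]
  exact isHermitian_ofSpectrum _ _

open Classical in
-- Eigenvectors in a degenerate eigenspace need not have definite parity, so the rank-one terms need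
-- not be even. Typicality, however, depends only on the product of the eigenvalues, so the sum is a
-- function of the even operator ρ^⊗N.
theorem isEvenOp_typicalProjector {ρ : FockOp ι} (hρ : IsNormalizedState ρ) (N : ℕ) (ε : ℝ) :
    IsEvenOp (typicalProjector ρ hρ.posSemidef.isHermitian N ε) := by
  have hH := hρ.posSemidef.isHermitian
  rw [typicalProjector_eq_ofSpectrum]
  refine isEvenOp_ofSpectrum
    (tensorPowerColumns_conjTranspose_mul hH.eigenvectorUnitary_conjTranspose_mul N)
    (tensorPowerColumns_mul_conjTranspose hH.eigenvectorUnitary_mul_conjTranspose N)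
    (p := fun x => ∏ j, hH.eigenvalues (x j)) ?_ fun x y h => ?_
  swap
  · have hiff : IsTypical hH.eigenvalues (fermionicEntropy ρ) ε x ↔
        IsTypical hH.eigenvalues (fermionicEntropy ρ) ε y := by
      simp only [IsTypical, h]
    exact if_congr hiff rfl rfl
  rw [← parallelPower_eq_ofSpectrum]
  exact (hρ.parallelPower N).even

theorem isAdmissibleKraus_typicalProjector {ρ : FockOp ι} (hρ : IsNormalizedState ρ) (N : ℕ)
    (ε : ℝ) : IsAdmissibleKraus (typicalProjector ρ hρ.posSemidef.isHermitian N ε) := by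
  have h := isHermitian_typicalProjector hρ.posSemidef.isHermitian N ε
  have h2 := typicalProjector_mul_self hρ.posSemidef.isHermitian N ε
  refine ⟨Or.inl (isEvenOp_typicalProjector hρ N ε), ?_⟩
  rw [h.eq, h2]
  exact posSemidef_one_sub_of_isHermitian_of_mul_self h h2

open Classical in
theorem trace_parallelPower_mul_typicalProjector {ρ : FockOp ι} (hρ : IsNormalizedState ρ) (N : ℕ)
    (ε : ℝ) :
    (parallelPower ρ N * typicalProjector ρ hρ.posSemidef.isHermitian N ε).trace =
      ((1 - ∑ x : Fin N → Occ ι,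
        if IsTypical hρ.posSemidef.isHermitian.eigenvalues (fermionicEntropy ρ) ε x then 0
        else ∏ j, hρ.posSemidef.isHermitian.eigenvalues (x j) : ℝ) : ℂ) := by
  have hH := hρ.posSemidef.isHermitian
  have hU := tensorPowerColumns_conjTranspose_mul hH.eigenvectorUnitary_conjTranspose_mul N
  rw [parallelPower_eq_ofSpectrum hH, typicalProjector_eq_ofSpectrum, ofSpectrum_mul hU,
    trace_ofSpectrum hU, ← Complex.ofReal_sum]
  congr 1
  rw [eq_sub_iff_add_eq, ← Finset.sum_add_distrib]
  refine Eq.trans ?_ (sum_pi_prod_eq_one hρ.eigenvalues_sum N)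
  refine Finset.sum_congr rfl fun x _ => ?_
  split_ifs <;> simp

theorem rank_typicalProjector_le {ρ : FockOp ι} (hρ : IsNormalizedState ρ) {N : ℕ} (hN : 0 < N)
    (ε : ℝ) :
    ((typicalProjector ρ hρ.posSemidef.isHermitian N ε).rank : ℝ) ≤
      (2 : ℝ) ^ ((N : ℝ) * (fermionicEntropy ρ + ε)) := by
  classical
  rw [typicalProjector_eq_ofSpectrum]
  refine le_trans ?_ (card_isTypical_le hρ.posSemidef.eigenvalues_nonneg hρ.eigenvalues_sum
    (fermionicEntropy ρ) ε hN)
  refine Nat.cast_le.mpr ((rank_ofSpectrum_le _ _).trans (le_of_eq ?_))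
  exact Fintype.card_congr (Equiv.subtypeEquivRight fun x => by simp)

end ParallelPower

/-! ### One-shot bounds for compression -/

section Bounds

open Matrix

variable {ι κ : Type} [Fintype ι] [Fintype κ] [DecidableEq ι] [DecidableEq κ]

/-- The Kraus operators of a composite are the products of the Kraus operators. -/
theorem kraus_comp {E : FockOp ι →ₗ[ℂ] FockOp κ} {D : FockOp κ →ₗ[ℂ] FockOp ι}
    {m n : ℕ} {A : Fin m → FockHom ι κ} {B : Fin n → FockHom κ ι}
    (hE : ∀ X, E X = ∑ i, A i * X * (A i)ᴴ) (hD : ∀ X, D X = ∑ j, B j * X * (B j)ᴴ) (X : FockOp ι) :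
    (D ∘ₗ E) X = ∑ q : Fin n × Fin m, B q.1 * A q.2 * X * (B q.1 * A q.2)ᴴ := by
  rw [LinearMap.comp_apply, hD, hE, Fintype.sum_prod_type]
  refine Finset.sum_congr rfl fun j _ => ?_
  rw [Matrix.mul_sum, Matrix.sum_mul]
  refine Finset.sum_congr rfl fun i _ => ?_
  rw [conjTranspose_mul]
  simp only [Matrix.mul_assoc]

/-- An even projection of rank at most `2 ^ M` is `V V†` for an even operator `V` from the Fock space
of `M + 1` modes. -/
theorem exists_isEvenOp_mul_conjTranspose_eq_projection {P : FockOp ι} (hP : P.IsHermitian)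
    (hP2 : P * P = P) (he : IsEvenOp P) {M : ℕ} (hr : P.rank ≤ 2 ^ M) :
    ∃ V : FockHom (Fin (M + 1)) ι, IsEvenOp V ∧ V * Vᴴ = P := by
  -- The block of P in each sector has rank at most 2^M, even if one sector carries all of P, and is
  -- factored through the sector of the same parity of the M + 1 modes.
  let Pi : ZMod 2 → FockOp ι := fun c => diagonal fun s => if parity s = c then 1 else 0
  have hQ : ∀ c, (Pi c * P * (Pi c)ᴴ).PosSemidef := fun c => by
    have hpos : P.PosSemidef := by
      have := posSemidef_conjTranspose_mul_self P
      rwa [hP.eq, hP2] at this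
    exact hpos.mul_mul_conjTranspose_same _
  have hQr : ∀ c, (Pi c * P * (Pi c)ᴴ).rank ≤
      Fintype.card {k : Occ (Fin (M + 1)) // parity k = c} := fun c =>
    ((rank_mul_le_left _ _).trans (rank_mul_le_right _ _)).trans
      (hr.trans (two_pow_le_card_sector M c))
  choose V hV using fun c => (hQ c).exists_mul_conjTranspose_eq (hQr c)
  have hQapp : ∀ c s t, (Pi c * P * (Pi c)ᴴ) s t =
      if parity s = c ∧ parity t = c then P s t else 0 := by
    intro c s t
    have h : (Pi c)ᴴ = Pi c := by
      simp only [Pi, diagonal_conjTranspose]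
      congr 1
      ext s
      simp [apply_ite]
    rw [h]
    simp only [Pi, mul_diagonal, diagonal_mul]
    by_cases hs : parity s = c <;> by_cases ht : parity t = c <;> simp [hs, ht]
  -- A vanishing diagonal entry of V V† is the squared norm of a row of V, so that row is zero.
  have hV0 : ∀ c s k, parity s ≠ c → V c s k = 0 := by
    intro c s k hs
    have h := congrFun (congrFun (hV c) s) s
    rw [hQapp, if_neg (fun h => hs h.1), mul_apply] at h
    simp only [conjTranspose_apply, RCLike.star_def, Complex.mul_conj'] at h
    have h' : ∑ k, ‖V c s k‖ ^ 2 = 0 := by exact_mod_cast h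
    have := (Finset.sum_eq_zero_iff_of_nonneg fun k _ => by positivity).mp h' k (Finset.mem_univ k)
    simpa using this
  refine ⟨of fun s k => V (parity k) s ⟨k, rfl⟩, fun s k hsk => hV0 _ _ _ hsk, ?_⟩
  ext s t
  have hsum : ∀ f : Occ (Fin (M + 1)) → ℂ,
      ∑ k, f k = ∑ c : ZMod 2, ∑ k : {k : Occ (Fin (M + 1)) // parity k = c}, f k := fun f =>
    (Fintype.sum_fiberwise parity f).symm
  rw [mul_apply, hsum]
  have hc : ∀ c, ∑ k : {k : Occ (Fin (M + 1)) // parity k = c},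
      (of fun s k => V (parity k) s ⟨k, rfl⟩ : FockHom (Fin (M + 1)) ι) s k *
        (of fun s k => V (parity k) s ⟨k, rfl⟩ : FockHom (Fin (M + 1)) ι)ᴴ k t =
      if parity s = c ∧ parity t = c then P s t else 0 := by
    intro c
    rw [← hQapp, ← hV, mul_apply]
    refine Finset.sum_congr rfl ?_
    rintro ⟨k, rfl⟩ -
    rfl
  simp only [hc]
  by_cases h : parity s = parity t
  · rw [Finset.sum_eq_single (parity s)]
    · rw [if_pos ⟨rfl, h.symm⟩]
    · intro c _ hcs
      rw [if_neg fun h' => hcs h'.1.symm]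
    · simp
  · rw [he s t h]
    simp

/-- Compressing onto an even projection `P` of rank at most `2 ^ M` with `M + 1` modes has
entanglement fidelity at least `|Tr (ρ P)|²`. -/
theorem exists_compression_of_projection {ρ : FockOp ι} (hρ : IsNormalizedState ρ) {P : FockOp ι}
    (hP : P.IsHermitian) (hP2 : P * P = P) (he : IsEvenOp P) {M : ℕ} (hr : P.rank ≤ 2 ^ M) :
    ∃ (E : FockOp ι →ₗ[ℂ] FockOp (Fin (M + 1))) (D : FockOp (Fin (M + 1)) →ₗ[ℂ] FockOp ι),
      IsFermionicChannel E ∧ IsFermionicChannel D ∧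
      ∃ F, IsEntanglementFidelity ρ (D ∘ₗ E) F ∧ ‖(ρ * P).trace‖ ^ 2 ≤ F := by
  obtain ⟨V, hVe, hV⟩ := exists_isEvenOp_mul_conjTranspose_eq_projection hP hP2 he hr
  have hPV : P * V = V := by
    have h0 : (P - 1) * (V * Vᴴ) = 0 := by
      rw [hV, Matrix.sub_mul, hP2, Matrix.one_mul, sub_self]
    rw [mul_self_mul_conjTranspose_eq_zero, Matrix.sub_mul, Matrix.one_mul, sub_eq_zero] at h0
    exact h0
  obtain ⟨E, m, A, i₀, hE, hEA, hi₀⟩ :=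
    exists_isFermionicChannel_of_contraction (W := Vᴴ) (IsEvenOp.conjTranspose hVe) (by
      rw [conjTranspose_conjTranspose, hV]
      exact posSemidef_one_sub_of_isHermitian_of_mul_self hP hP2)
  obtain ⟨D, n, B, j₀, hD, hDB, hj₀⟩ :=
    exists_isFermionicChannel_of_contraction (W := V) hVe (by
      refine posSemidef_one_sub_of_isHermitian_of_mul_self (isHermitian_conjTranspose_mul_self V) ?_
      rw [Matrix.mul_assoc, ← Matrix.mul_assoc V, hV, hPV])
  refine ⟨E, D, hE, hD, _, isEntanglementFidelity_of_kraus hρ (kraus_comp hEA hDB), ?_⟩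
  -- Of all the products of Kraus operators only V V† = P is kept.
  have h := Finset.single_le_sum
    (f := fun q : Fin n × Fin m => ‖(ρ * (B q.1 * A q.2)).trace‖ ^ 2)
    (fun q _ => by positivity) (Finset.mem_univ (j₀, i₀))
  simpa only [hi₀, hj₀, hV] using h

theorem trace_conjTranspose_mul_self_re {n m : Type*} [Fintype n] [Fintype m] (X : Matrix n m ℂ) :
    (Xᴴ * X).trace.re = ∑ q : m × n, ‖X q.2 q.1‖ ^ 2 := by
  rw [trace, Complex.re_sum, Fintype.sum_prod_type]
  refine Finset.sum_congr rfl fun i _ => ?_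
  rw [diag_apply, mul_apply, Complex.re_sum]
  refine Finset.sum_congr rfl fun j _ => ?_
  rw [conjTranspose_apply, RCLike.star_def, Complex.conj_mul']
  norm_cast

/-- The Cauchy–Schwarz inequality for the Hilbert–Schmidt inner product. -/
theorem norm_trace_conjTranspose_mul_sq_le {n m : Type*} [Fintype n] [Fintype m]
    (X Y : Matrix n m ℂ) :
    ‖(Xᴴ * Y).trace‖ ^ 2 ≤ (Xᴴ * X).trace.re * (Yᴴ * Y).trace.re := by
  rw [trace_conjTranspose_mul_self_re, trace_conjTranspose_mul_self_re]
  refine le_trans (pow_le_pow_left₀ (norm_nonneg _) ?_ 2)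
    (Finset.sum_mul_sq_le_sq_mul_sq Finset.univ (fun q : m × n => ‖X q.2 q.1‖)
      fun q => ‖Y q.2 q.1‖)
  rw [trace, Fintype.sum_prod_type]
  refine (norm_sum_le _ _).trans (Finset.sum_le_sum fun i _ => ?_)
  rw [diag_apply, mul_apply]
  refine (norm_sum_le _ _).trans (Finset.sum_le_sum fun j _ => le_of_eq ?_)
  rw [conjTranspose_apply, norm_mul, norm_star]

/-- Cauchy–Schwarz for QB and AB, to be used with B = √ρ and Q the projection onto the range of a
decoding Kraus operator. -/
theorem norm_trace_mul_mul_sq_le {n : Type*} [Fintype n] {B Q : Matrix n n ℂ}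
    (hB : B.IsHermitian) (hQ : Q.IsHermitian) (hQ2 : Q * Q = Q) (A : Matrix n n ℂ) :
    ‖(B * B * (Q * A)).trace‖ ^ 2 ≤ (B * B * Q).trace.re * (B * B * (Aᴴ * A)).trace.re := by
  have h := norm_trace_conjTranspose_mul_sq_le (Q * B) (A * B)
  have h1 : ((Q * B)ᴴ * (A * B)).trace = (B * B * (Q * A)).trace := by
    rw [conjTranspose_mul, hB.eq, hQ.eq, ← Matrix.mul_assoc, trace_mul_comm]
    simp only [Matrix.mul_assoc]
  have h2 : ((Q * B)ᴴ * (Q * B)).trace = (B * B * Q).trace := by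
    rw [conjTranspose_mul, hB.eq, hQ.eq, Matrix.mul_assoc, ← Matrix.mul_assoc Q, hQ2,
      ← Matrix.mul_assoc, trace_mul_comm, Matrix.mul_assoc]
  have h3 : ((A * B)ᴴ * (A * B)).trace = (B * B * (Aᴴ * A)).trace := by
    rw [conjTranspose_mul, hB.eq, ← Matrix.mul_assoc, trace_mul_comm]
    simp only [Matrix.mul_assoc]
  rwa [h1, h2, h3] at h

/-- The entanglement fidelity of a compression into a system of modes `κ` is at most the largest
weight that the state puts on a subspace of the dimension of the Fock space of `κ`. -/
theorem exists_isEntanglementFidelity_le {ρ : FockOp ι} (hρ : IsNormalizedState ρ)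
    {E : FockOp ι →ₗ[ℂ] FockOp κ} {D : FockOp κ →ₗ[ℂ] FockOp ι}
    (hE : IsFermionicChannel E) (hD : IsFermionicChannel D) {b : ℝ}
    (hb : ∀ Q : FockOp ι, Q.IsHermitian → Q * Q = Q → Q.trace.re ≤ Fintype.card (Occ κ) →
      (ρ * Q).trace.re ≤ b) :
    ∃ F, IsEntanglementFidelity ρ (D ∘ₗ E) F ∧ F ≤ b := by
  obtain ⟨m, A, -, hA1, hEA⟩ := hE
  obtain ⟨n, C, -, hC1, hDC⟩ := hD
  refine ⟨_, isEntanglementFidelity_of_kraus hρ (kraus_comp hEA hDC), ?_⟩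
  obtain ⟨B, -, hBh, hB⟩ := exists_isEvenOp_mul_conjTranspose_eq hρ.posSemidef hρ.even
  have key : ∀ q : Fin n × Fin m, ‖(ρ * (C q.1 * A q.2)).trace‖ ^ 2 ≤
      b * (ρ * ((C q.1 * A q.2)ᴴ * (C q.1 * A q.2))).trace.re := by
    intro q
    obtain ⟨Q, hQ, hQ2, hQC, hQt⟩ := exists_range_projection (C q.1)
    have h := norm_trace_mul_mul_sq_le hBh hQ hQ2 (C q.1 * A q.2)
    rw [← Matrix.mul_assoc Q, hQC, hB] at h
    refine h.trans (mul_le_mul_of_nonneg_right (hb Q hQ hQ2 hQt) ?_)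
    have h3 : (ρ * ((C q.1 * A q.2)ᴴ * (C q.1 * A q.2))).trace =
        ((C q.1 * A q.2 * B)ᴴ * (C q.1 * A q.2 * B)).trace := by
      rw [← hB, conjTranspose_mul (C q.1 * A q.2) B, hBh.eq, Matrix.mul_assoc B B,
        trace_mul_comm B]
      simp only [Matrix.mul_assoc]
    rw [h3, trace_conjTranspose_mul_self_re]
    exact Finset.sum_nonneg fun _ _ => by positivity
  -- Trace preservation makes the second Cauchy–Schwarz factors sum to Tr ρ = 1, leaving b.
  have hsum : ∑ q : Fin n × Fin m, (C q.1 * A q.2)ᴴ * (C q.1 * A q.2) = 1 := by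
    rw [Fintype.sum_prod_type_right, ← hA1]
    refine Finset.sum_congr rfl fun i _ => ?_
    have : ∀ j, (C j * A i)ᴴ * (C j * A i) = (A i)ᴴ * ((C j)ᴴ * C j) * A i := fun j => by
      rw [conjTranspose_mul]
      simp only [Matrix.mul_assoc]
    simp only [this]
    rw [← Matrix.sum_mul, ← Matrix.mul_sum, hC1, Matrix.mul_one]
  refine (Finset.sum_le_sum fun q _ => key q).trans (le_of_eq ?_)
  rw [← Finset.mul_sum, ← Complex.re_sum, ← trace_sum, ← Finset.mul_sum, hsum, Matrix.mul_one,
    hρ.trace_eq_one, Complex.one_re, mul_one]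

/-- The weight of an operator with spectrum `p` on a subspace, when `p ≤ c` outside of a set of
eigenvectors of total weight `η`. -/
theorem re_trace_ofSpectrum_mul_projection_le {n m : Type*} [Fintype n] [DecidableEq n] [Fintype m]
    [DecidableEq m] {U : Matrix n m ℂ} (hU : Uᴴ * U = 1) (hU' : U * Uᴴ = 1) {p : m → ℝ}
    (hp : ∀ x, 0 ≤ p x) {Q : Matrix n n ℂ} (hQ : Q.IsHermitian) (hQ2 : Q * Q = Q)
    {S : m → Prop} [DecidablePred S] {c : ℝ} (hc : 0 ≤ c) (hS : ∀ x, S x → p x ≤ c) :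
    (ofSpectrum U p * Q).trace.re ≤ c * Q.trace.re + ∑ x, if S x then 0 else p x := by
  have hdiag : ∀ R : Matrix n n ℂ, R.IsHermitian → R * R = R → ∀ x, 0 ≤ ((Uᴴ * R * U) x x).re := by
    intro R hR hR2 x
    have h : Uᴴ * R * U = Uᴴ * R * (Uᴴ)ᴴ := by rw [conjTranspose_conjTranspose]
    have hpos : R.PosSemidef := by
      have := posSemidef_conjTranspose_mul_self R
      rwa [hR.eq, hR2] at this
    rw [h]
    exact (Complex.nonneg_iff.mp (hpos.mul_mul_conjTranspose_same Uᴴ).diag_nonneg).1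
  -- The diagonal entries of Q in the eigenbasis lie in [0, 1] and sum to Tr Q: the bound p ≤ c is
  -- used on S, and the bound 1 on the entry elsewhere.
  have h0 := hdiag Q hQ hQ2
  have h1 : ∀ x, ((Uᴴ * Q * U) x x).re ≤ 1 := by
    intro x
    have h := hdiag (1 - Q) (isHermitian_one.sub hQ) (by
      rw [Matrix.sub_mul, Matrix.one_mul, Matrix.mul_sub, hQ2]
      simp) x
    rw [Matrix.mul_sub, Matrix.sub_mul, Matrix.mul_one, hU, Matrix.sub_apply, one_apply_eq,
      Complex.sub_re, Complex.one_re] at h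
    linarith
  have htr : Q.trace.re = ∑ x, ((Uᴴ * Q * U) x x).re := by
    rw [← Complex.re_sum]
    congr 1
    have : (Uᴴ * Q * U).trace = Q.trace := by
      rw [trace_mul_comm, ← Matrix.mul_assoc, hU', Matrix.one_mul]
    exact this.symm
  rw [trace_ofSpectrum_mul, Complex.re_sum, htr, Finset.mul_sum, ← Finset.sum_add_distrib]
  refine Finset.sum_le_sum fun x _ => ?_
  rw [Complex.re_ofReal_mul]
  split_ifs with h
  · rw [add_zero]
    exact mul_le_mul_of_nonneg_right (hS x h) (h0 x)
  · have := mul_le_mul_of_nonneg_left (h1 x) (hp x)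
    have := mul_nonneg hc (h0 x)
    linarith

end Bounds

/-! ### Asymptotic rates -/

section Asymptotics

theorem fermionicEntropy_nonneg {ι : Type} [Fintype ι] [DecidableEq ι] {ρ : FockOp ι}
    (hρ : IsNormalizedState ρ) : 0 ≤ fermionicEntropy ρ := by
  rw [fermionicEntropy_eq hρ.posSemidef.isHermitian, neg_nonneg]
  refine Finset.sum_nonpos fun x _ => ?_
  have h0 := hρ.posSemidef.eigenvalues_nonneg
  refine mul_nonpos_of_nonneg_of_nonpos (h0 x) (Real.logb_nonpos one_lt_two (h0 x) ?_)
  rw [← hρ.eigenvalues_sum]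
  exact Finset.single_le_sum (fun y _ => h0 y) (Finset.mem_univ x)

theorem CompressionScheme.rate_eq {L N : ℕ} (c : CompressionScheme L N) :
    c.rate = (c.modes : ℝ) / N := by
  rw [CompressionScheme.rate, card_occ, Nat.cast_pow, Nat.cast_ofNat, Real.logb_pow,
    Real.logb_self_eq_one one_lt_two, mul_one]

/-- The variance of the information content of the eigenvalues of a state. -/
noncomputable def informationVariance {ι : Type} [Fintype ι] [DecidableEq ι] (ρ : FockOp ι)
    (hρ : ρ.IsHermitian) : ℝ :=
  ∑ x, hρ.eigenvalues x * (-Real.logb 2 (hρ.eigenvalues x) - fermionicEntropy ρ) ^ 2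

variable {L : ℕ} {ρ : FockOp (Fin L)}

open Classical in
theorem sum_not_isTypical_eigenvalues_le (hρ : IsNormalizedState ρ) {ε : ℝ} (hε : 0 < ε) {N : ℕ}
    (hN : 0 < N) :
    ∑ x : Fin N → Occ (Fin L),
      (if IsTypical hρ.posSemidef.isHermitian.eigenvalues (fermionicEntropy ρ) ε x then 0
        else ∏ j, hρ.posSemidef.isHermitian.eigenvalues (x j)) ≤
      informationVariance ρ hρ.posSemidef.isHermitian / ε ^ 2 / N :=
  sum_not_isTypical_le hρ.posSemidef.eigenvalues_nonneg hρ.eigenvalues_sum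
    (fermionicEntropy_eq hρ.posSemidef.isHermitian) hε hN

theorem exists_forall_div_le (V : ℝ) {η : ℝ} (hη : 0 < η) :
    ∃ N₀ : ℕ, ∀ N : ℕ, N₀ ≤ N → V / N ≤ η :=
  Filter.eventually_atTop.mp ((tendsto_const_div_atTop_nhds_zero_nat V).eventually_le_const hη)

theorem exists_forall_le_mul (b : ℝ) {ε : ℝ} (hε : 0 < ε) :
    ∃ N₀ : ℕ, ∀ N : ℕ, N₀ ≤ N → b ≤ N * ε :=
  Filter.eventually_atTop.mp
    ((tendsto_natCast_atTop_atTop.atTop_mul_const hε).eventually_ge_atTop b)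

/-- Fermionic source coding, direct part. -/
theorem exists_compressionScheme (hρ : IsNormalizedState ρ) {R : ℝ} (hR : fermionicEntropy ρ < R)
    {δ : ℝ} (hδ : 0 < δ) :
    ∃ N₀ : ℕ, ∀ N : ℕ, N₀ ≤ N → ∃ c : CompressionScheme L N,
      (R - 1 / (N : ℝ) < c.rate ∧ c.rate ≤ R) ∧
      ∃ F : ℝ, IsEntanglementFidelity (parallelPower ρ N) c.compression F ∧ 1 - δ ≤ F := by
  classical
  set S := fermionicEntropy ρ with hS
  have hS0 : 0 ≤ S := fermionicEntropy_nonneg hρ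
  have hH := hρ.posSemidef.isHermitian
  -- Half of the gap R - S pays for the size of the typical subspace, the other half for rounding
  -- and the parity mode. The atypical weight η is made at most δ/2 because (1 - η)² ≥ 1 - 2η.
  obtain ⟨ε, hε, hRε⟩ : ∃ ε : ℝ, 0 < ε ∧ R = S + 2 * ε := ⟨(R - S) / 2, by linarith, by ring⟩
  obtain ⟨N₁, hN₁⟩ := exists_forall_div_le (informationVariance ρ hH / ε ^ 2) (half_pos hδ)
  -- The constant 2 counts one mode lost to the floor and one to parity: with M + 1 = ⌊NR⌋, M > NR -
  -- 2 ≥ N(S + ε).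
  obtain ⟨N₂, hN₂⟩ := exists_forall_le_mul 2 hε
  refine ⟨N₁ + N₂ + 1, fun N hN => ?_⟩
  have hN0 : 0 < N := by omega
  have hN' : (0 : ℝ) < N := by exact_mod_cast hN0
  have h1 := (sum_not_isTypical_eigenvalues_le hρ hε hN0).trans (hN₁ N (by omega))
  have h2 := hN₂ N (by omega)
  have h3 := trace_parallelPower_mul_typicalProjector hρ N ε
  rw [← hS] at h1 h3
  set η := ∑ x : Fin N → Occ (Fin L), if IsTypical hρ.posSemidef.isHermitian.eigenvalues S ε x
    then 0 else ∏ j, hρ.posSemidef.isHermitian.eigenvalues (x j)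
  have hNS : 0 ≤ N * S := by positivity
  have hNR : N * R = N * (S + ε) + N * ε := by rw [hRε]; ring
  have hNR0 : 0 ≤ N * R := by rw [hNR]; positivity
  have hfl : 1 ≤ ⌊N * R⌋₊ := Nat.le_floor (by rw [Nat.cast_one]; nlinarith)
  obtain ⟨M, hM⟩ := Nat.exists_eq_add_of_le' hfl
  have hlt := Nat.lt_floor_add_one (N * R)
  have hle := Nat.floor_le hNR0
  rw [hM] at hlt hle
  push_cast at hlt hle
  have hrank : (typicalProjector ρ hρ.posSemidef.isHermitian N ε).rank ≤ 2 ^ M := by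
    have h := rank_typicalProjector_le hρ hN0 ε
    have h' : (2 : ℝ) ^ ((N : ℝ) * (S + ε)) ≤ (2 : ℝ) ^ (M : ℝ) :=
      Real.rpow_le_rpow_of_exponent_le one_le_two (by linarith)
    rw [Real.rpow_natCast] at h'
    exact_mod_cast h.trans h'
  obtain ⟨E, D, hE, hD, F, hF, hPF⟩ := exists_compression_of_projection (hρ.parallelPower N)
    (isHermitian_typicalProjector hρ.posSemidef.isHermitian N ε)
    (typicalProjector_mul_self hρ.posSemidef.isHermitian N ε) (isEvenOp_typicalProjector hρ N ε)
    hrank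
  let c : CompressionScheme L N := ⟨M + 1, E, D, hE, hD⟩
  have hrate : c.rate = ((M : ℝ) + 1) / N := by
    rw [c.rate_eq]
    exact congrArg (fun r : ℝ => r / N) (Nat.cast_succ M)
  refine ⟨c, ⟨?_, ?_⟩, F, hF, ?_⟩
  · rw [hrate, sub_lt_iff_lt_add, ← add_div, lt_div_iff₀ hN']
    linarith
  · rw [hrate, div_le_iff₀ hN']
    linarith
  · rw [h3, Complex.norm_real, Real.norm_eq_abs, sq_abs] at hPF
    nlinarith [sq_nonneg η]

/-- Fermionic source coding, converse part. -/
theorem exists_fidelity_le (hρ : IsNormalizedState ρ) {R : ℝ} (hR : R < fermionicEntropy ρ)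
    {δ : ℝ} (hδ : 0 < δ) :
    ∃ N₀ : ℕ, ∀ N : ℕ, N₀ ≤ N → ∀ c : CompressionScheme L N, c.rate ≤ R →
      ∃ F : ℝ, IsEntanglementFidelity (parallelPower ρ N) c.compression F ∧ F ≤ δ := by
  classical
  set S := fermionicEntropy ρ with hS
  have hH := hρ.posSemidef.isHermitian
  obtain ⟨ε, hε, hRε⟩ : ∃ ε : ℝ, 0 < ε ∧ R = S - 2 * ε := ⟨(S - R) / 2, by linarith, by ring⟩
  obtain ⟨N₁, hN₁⟩ := exists_forall_div_le (informationVariance ρ hH / ε ^ 2) (half_pos hδ)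
  -- Dimension 2^(NR) times the largest typical eigenvalue 2^(-N(S-ε)) is 2^(-Nε), which is at most
  -- δ/2 from here on; the atypical weight takes the other δ/2.
  obtain ⟨N₂, hN₂⟩ := exists_forall_le_mul (-Real.logb 2 (δ / 2)) hε
  refine ⟨N₁ + N₂ + 1, fun N hN c hc => ?_⟩
  have hN0 : 0 < N := by omega
  have hN' : (0 : ℝ) < N := by exact_mod_cast hN0
  have h1 := (sum_not_isTypical_eigenvalues_le hρ hε hN0).trans (hN₁ N (by omega))
  have h2 := hN₂ N (by omega)
  rw [← hS] at h1
  refine exists_isEntanglementFidelity_le (hρ.parallelPower N) c.encode_channel c.decode_channel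
    fun Q hQ hQ2 hQt => ?_
  rw [parallelPower_eq_ofSpectrum hρ.posSemidef.isHermitian]
  refine (re_trace_ofSpectrum_mul_projection_le
    (tensorPowerColumns_conjTranspose_mul
      hρ.posSemidef.isHermitian.eigenvectorUnitary_conjTranspose_mul N)
    (tensorPowerColumns_mul_conjTranspose
      hρ.posSemidef.isHermitian.eigenvectorUnitary_mul_conjTranspose N)
    (fun x => Finset.prod_nonneg fun j _ => hρ.posSemidef.eigenvalues_nonneg _) hQ hQ2
    (S := fun x => IsTypical hρ.posSemidef.isHermitian.eigenvalues S ε x)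
    (c := (2 : ℝ) ^ (-((N : ℝ) * (S - ε)))) (by positivity)
    fun x hx => (hx.bounds hN0).2).trans ?_
  have hmodes : (c.modes : ℝ) ≤ N * R := by
    rw [c.rate_eq, div_le_iff₀ hN'] at hc
    linarith
  have hdim : (2 : ℝ) ^ (-((N : ℝ) * (S - ε))) * Q.trace.re ≤ δ / 2 := by
    rw [card_occ, Nat.cast_pow, Nat.cast_ofNat, ← Real.rpow_natCast] at hQt
    refine (mul_le_mul_of_nonneg_left hQt (by positivity)).trans ?_
    rw [← Real.rpow_add two_pos, ← Real.le_logb_iff_rpow_le one_lt_two (half_pos hδ)]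
    have : (N : ℝ) * R = N * (S - ε) - N * ε := by rw [hRε]; ring
    linarith
  linarith

end Asymptotics

theorem theorem1 (L : ℕ) (ρ : FockOp (Fin L)) (hρ : IsNormalizedState ρ) :
    -- direct part
    (∀ R : ℝ, fermionicEntropy ρ < R → ∀ δ : ℝ, 0 < δ → ∃ N₀ : ℕ, ∀ N : ℕ, N₀ ≤ N →
      ∃ c : CompressionScheme L N,
        (R - 1 / (N : ℝ) < c.rate ∧ c.rate ≤ R) ∧
        ∃ F : ℝ, IsEntanglementFidelity (parallelPower ρ N) c.compression F ∧ 1 - δ ≤ F) ∧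
    -- converse part
    (∀ R : ℝ, R < fermionicEntropy ρ → ∀ δ : ℝ, 0 < δ → ∃ N₀ : ℕ, ∀ N : ℕ, N₀ ≤ N →
      ∀ c : CompressionScheme L N, c.rate ≤ R →
        ∃ F : ℝ, IsEntanglementFidelity (parallelPower ρ N) c.compression F ∧ F ≤ δ) ∧
    -- the projectors on the typical subspaces are admissible fermionic Kraus operators
    (∀ (N : ℕ) (ε : ℝ), 0 < ε →
      IsAdmissibleKraus (typicalProjector ρ hρ.posSemidef.isHermitian N ε)) := by
  exact ⟨fun _ hR _ hδ => exists_compressionScheme hρ hR hδ,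
    fun _ hR _ hδ => exists_fidelity_le hρ hR hδ,
    fun N ε _ => isAdmissibleKraus_typicalProjector hρ N ε⟩
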